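/- Let $G=(V,E)$ be a finite directed graph without loops or multiple edges that is strongly connected, with vertex set $V=[n]=\{1,\dots,n\}$, $n\ge 1$, and $m=|E|$ edges. Let $$\Theta_G=\{A\in\mathbb{C}^{n\times n} : A_{ij}=0 \text{ whenever } i\neq j \text{ and } j\to i \text{ is not an edge of } G\},$$ a linear space of dimension $n+m$. For a matrix $A$ let $A_1$ be the matrix obtained by deleting its first row and first column, and let $$c:\Theta_G\to\mathbb{C}^{2n-1},\qquad c(A)=(c_1,\dots,c_n,d_1,\dots,d_{n-1}),$$ be the map given by the non-leading coefficients of the characteristic polynomials $\det(\lambda I-A)=\lambda^n+c_1\lambda^{n-1}+\dots+c_n$ and $\det(\lambda I-A_1)=\lambda^{n-1}+d_1\lambda^{n-2}+\dots+d_{n-1}$. We say that $G$ has the expected dimension if the image of $c$ (that is, its Zariski closure) has dimension $m+1$. Then $G$ has the expected dimension if and only if, for all $A$ in some nonempty Zariski open subset of $\Theta_G$, there is no nonzero matrix $X\in\mathbb{C}^{n\times n}$ with $X_{1i}=X_{i1}=X_{ii}=0$ for all $i\in[n]$ such that $[X,A]=XA-AX$ lies in $\Theta_G$. -/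

import Mathlib

namespace CompartmentModel

variable {V : Type*}

/-- There is a directed (possibly empty) path from every vertex to every other vertex. -/
def StronglyConnected (G : Digraph V) : Prop :=
  ∀ u v : V, Relation.ReflTransGen G.Adj u v

/-- The number `m` of edges of `G`. -/
noncomputable def numEdges (G : Digraph V) : ℕ :=
  {e : V × V | G.Adj e.1 e.2}.ncard

/-- The complex parameter space `Θ_G`: all matrices that vanish at every off-diagonal position
`(i, j)` for which `j → i` is not an edge of `G`. The diagonal entries are free, because each
compartment has its own independent leak parameter. -/
def parameterSpace (G : Digraph V) : Submodule ℂ (Matrix V V ℂ) where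
  carrier := {A | ∀ i j : V, i ≠ j → ¬ G.Adj j i → A i j = 0}
  zero_mem' := fun _ _ _ _ => rfl
  add_mem' := fun hA hB i j hij hG => by
    rw [Matrix.add_apply, hA i j hij hG, hB i j hij hG, add_zero]
  smul_mem' := fun c A hA i j hij hG => by
    rw [Matrix.smul_apply, hA i j hij hG, smul_zero]

/-- The matrix `A₁` obtained from `A` by deleting the row and the column of the vertex `r`. -/
def deleteVertex (r : V) (A : Matrix V V ℂ) : Matrix {v : V // v ≠ r} {v : V // v ≠ r} ℂ :=
  A.submatrix Subtype.val Subtype.val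

/-- The double characteristic polynomial map `A ↦ (c₁, …, cₙ, d₁, …, dₙ₋₁)`, where
`det (λ I - A) = λ ^ n + c₁ λ ^ (n - 1) + ⋯ + cₙ` and
`det (λ I - A₁) = λ ^ (n - 1) + d₁ λ ^ (n - 2) + ⋯ + dₙ₋₁`, with `n` the number of vertices and
`r` the input-output compartment. Indices start at `0`, so that `i : Fin n` stands for the
coefficient of `λ ^ (n - 1 - i)`. -/
noncomputable def doubleCharpolyMap [Fintype V] [DecidableEq V] (r : V) (A : Matrix V V ℂ) :
    Fin (Fintype.card V) ⊕ Fin (Fintype.card V - 1) → ℂ :=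
  Sum.elim (fun i => A.charpoly.coeff i.rev) (fun i => (deleteVertex r A).charpoly.coeff i.rev)

/-- The dimension of a subset `S` of affine space: the Krull dimension of the coordinate ring of
the Zariski closure of `S`. -/
noncomputable def zariskiDim {σ : Type*} (S : Set (σ → ℂ)) : WithBot ℕ∞ :=
  ringKrullDim (MvPolynomial σ ℂ ⧸ MvPolynomial.vanishingIdeal ℂ S)

/-- `G`, with input-output compartment `r`, has the expected dimension: the image of `Θ_G` under
the double characteristic polynomial map has dimension `m + 1`. -/
def HasExpectedDimension [Fintype V] [DecidableEq V] (G : Digraph V) (r : V) : Prop :=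
  zariskiDim (doubleCharpolyMap r '' (parameterSpace G : Set (Matrix V V ℂ))) =
    ((numEdges G + 1 : ℕ) : WithBot ℕ∞)

/-- `P` holds for all sufficiently general `A` in the linear space `Θ`, that is, on a nonempty
Zariski open subset of `Θ`: there is a polynomial `f` in the matrix entries that does not vanish
identically on `Θ` such that `P A` holds for all `A ∈ Θ` with `f A ≠ 0`. -/
def ForGeneric (Θ : Submodule ℂ (Matrix V V ℂ)) (P : Matrix V V ℂ → Prop) : Prop :=
  ∃ f : MvPolynomial (V × V) ℂ,
    (∃ A ∈ Θ, MvPolynomial.eval (fun e => A e.1 e.2) f ≠ 0) ∧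
      ∀ A ∈ Θ, MvPolynomial.eval (fun e => A e.1 e.2) f ≠ 0 → P A

end CompartmentModel

/-! Write `n` for the number of vertices, `Θ` for the parameter space and `c` for the double
characteristic polynomial map. In characteristic zero the dimension of the closure of `c(Θ)` is the
rank of the Jacobian of `c` at a general point. Since `dim Θ = n + m`, the expected dimension `m +
1` means that the kernel of the Jacobian at a general `A` has dimension `n - 1`.

That kernel consists of the `B ∈ Θ` for which `A + εB` and `A` have the same two characteristic
polynomials over the dual numbers. If `X` has zero row and column at `r`, then `B = [X, A]`
preserves both polynomials, because `A + εB` is the conjugate of `A` by `1 + εX` and the same holds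
after deleting `r`. The converse is the main point (`Controllable.exists_commutator`). When `e_r` is
a cyclic vector of `A`, define `X` by sending `q(A) e_r` to the `ε`-part of `q(A + εB) e_r`.
Cayley-Hamilton makes this well defined. Row `r` of `X` vanishes because the two characteristic
polynomials determine all the numbers `(A ^ k) r r` (`pow_apply_self_eq_of_charpoly_eq`). Cyclicity
also makes `X ↦ [X, A]` injective on these matrices, so the kernel is isomorphic to the space of all
such `X` with `[X, A] ∈ Θ`.

That space always contains the `n - 1` dimensions of diagonal matrices vanishing at `r`. It is no
larger exactly when it contains no nonzero matrix with zero diagonal, which is the criterion.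
Cyclicity is a nonempty Zariski open condition on `Θ`: strong connectivity provides a spanning tree
rooted at `r`, and the tree plus a diagonal with distinct entries is an explicit cyclic example. -/

namespace CompartmentModel

/-! ### Integral extensions and derivations. -/

/-- An injective integral extension preserves the Krull dimension. -/
theorem ringKrullDim_eq_of_isIntegral {R S : Type*} [CommRing R] [CommRing S] [Algebra R S]
    [Algebra.IsIntegral R S] [FaithfulSMul R S] : ringKrullDim S = ringKrullDim R := by
  apply le_antisymm
  · refine Order.krullDim_le_of_strictMono (PrimeSpectrum.comap (algebraMap R S)) ?_
    intro I J hIJ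
    have : I.asIdeal < J.asIdeal := hIJ
    exact Ideal.IsIntegral.comap_lt_comap this
  -- Lying over provides a prime above the head of the chain, and going up lifts the rest with the
  -- same length.
  · refine iSup_le fun l => ?_
    obtain ⟨P, hP, hPl⟩ := (inferInstance : Nonempty (Ideal.primesOver l.head.asIdeal S))
    have := hP
    have := hPl
    obtain ⟨l', hl', -⟩ := Ideal.exists_ltSeries_of_hasGoingUp (S := S) l P
    rw [← hl']
    exact le_iSup (fun l : LTSeries (PrimeSpectrum S) => ((l.length : ℕ∞) : WithBot ℕ∞)) l'

open Polynomial in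
/-- In characteristic zero, a derivation that kills `s` kills everything algebraic over `s`. -/
theorem derivation_eq_zero_of_isAlgebraic {k R M : Type*} [Field k] [CommRing R] [IsDomain R]
    [CharZero R] [Algebra k R] [AddCommGroup M] [Module R M] [Module k M]
    (htf : ∀ (c : R) (m : M), c • m = 0 → c = 0 ∨ m = 0)
    (D : Derivation k R M) {s : Set R} (hs : ∀ z ∈ s, D z = 0) {y : R}
    (hy : IsAlgebraic (Algebra.adjoin k s) y) : D y = 0 := by
  have hadj : ∀ z ∈ Algebra.adjoin k s, D z = 0 := fun z hz =>
    Derivation.eqOn_adjoin (D1 := D) (D2 := 0) (fun x hx => by simpa using hs x hx) hz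
  -- Since `D` kills the subalgebra generated by `s`, it is linear over it, so the chain rule
  -- applies to polynomials with coefficients there.
  let D' : Derivation (Algebra.adjoin k s) R M :=
    { toFun := D
      map_add' := D.map_add
      map_smul' := fun c x => by
        have : c • x = (c : R) * x := rfl
        rw [this, D.leibniz, hadj c c.2, smul_zero, add_zero]
        rfl
      map_one_eq_zero' := D.map_one_eq_zero
      leibniz' := D.leibniz }
  -- Differentiating `p(y) = 0` gives `p'(y) • D y = 0`. If `p'(y) = 0`, then `p'` is an
  -- annihilating polynomial of smaller degree, nonzero in characteristic zero, so no minimal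
  -- polynomial is needed.
  have key : ∀ (n : ℕ) (p : (Algebra.adjoin k s)[X]), p.natDegree = n → p ≠ 0 → aeval y p = 0 →
      D y = 0 := by
    intro n
    induction n using Nat.strong_induction_on with
    | _ n ih =>
      intro p hn hp hpy
      by_cases h0 : n = 0
      · exfalso
        rw [natDegree_eq_zero.mp (hn.trans h0) |>.choose_spec.symm] at hpy hp
        rw [aeval_C] at hpy
        apply hp
        rw [C_eq_zero]
        exact Subtype.ext hpy
      · have hd : derivative p ≠ 0 := by
          intro h
          exact h0 (hn ▸ Polynomial.derivative_eq_zero.mp h)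
        have h1 : aeval y (derivative p) • D y = 0 := by
          have := D'.map_aeval p y
          rw [hpy, map_zero] at this
          exact this.symm
        rcases htf _ _ h1 with h | h
        · exact ih _ (hn ▸ natDegree_derivative_lt (hn ▸ h0)) _ rfl hd h
        · exact h
  obtain ⟨p, hp, hpy⟩ := hy
  exact key _ p rfl hp hpy

open MvPolynomial

/-! ### The Jacobian criterion for algebraic dimension. -/

section Jacobian

variable {k ι : Type*} [Field k]

variable (k ι) in
/-- The gradient of a polynomial, as a vector over the field of rational functions. -/
noncomputable def gradient [DecidableEq ι] :
    Derivation k (MvPolynomial ι k) (ι → FractionRing (MvPolynomial ι k)) :=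
  mkDerivation k (fun i => Pi.single i 1)

theorem gradient_apply [DecidableEq ι] (f : MvPolynomial ι k) (i : ι) :
    gradient k ι f i = algebraMap _ (FractionRing (MvPolynomial ι k)) (pderiv i f) := by
  induction f using MvPolynomial.induction_on with
  | C a => simp [gradient]
  | add p q hp hq => simp [hp, hq]
  | mul_X p j hp =>
    rw [Derivation.leibniz, Pi.add_apply, Pi.smul_apply, Pi.smul_apply, hp, pderiv_mul, pderiv_X]
    by_cases h : i = j
    · subst h
      simp [gradient, Algebra.smul_def, mul_comm, add_comm]
    · simp [gradient, Algebra.smul_def, mul_comm, h]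

variable [CharZero k] [DecidableEq ι]

/-- The gradient of a polynomial algebraic over others is in the span of their gradients. -/
theorem gradient_mem_span_of_isAlgebraic {s : Set (MvPolynomial ι k)} {y : MvPolynomial ι k}
    (hy : IsAlgebraic (Algebra.adjoin k s) y) :
    gradient k ι y ∈ Submodule.span (FractionRing (MvPolynomial ι k)) (gradient k ι '' s) := by
  set N := Submodule.span (FractionRing (MvPolynomial ι k)) (gradient k ι '' s)
  -- The gradient modulo `N` is a derivation that kills `s`, hence kills everything algebraic over
  -- `s`.
  let D : Derivation k (MvPolynomial ι k) ((ι → FractionRing (MvPolynomial ι k)) ⧸ N) :=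
    (N.mkQ.restrictScalars (MvPolynomial ι k)).compDer (gradient k ι)
  have hD : ∀ x, D x = N.mkQ (gradient k ι x) := fun _ => rfl
  rw [← Submodule.ker_mkQ N, LinearMap.mem_ker, ← hD]
  have : CharZero (MvPolynomial ι k) := charZero_of_injective_algebraMap (C_injective ι k)
  refine derivation_eq_zero_of_isAlgebraic ?_ D ?_ hy
  · intro c m hcm
    rw [← algebraMap_smul (FractionRing (MvPolynomial ι k)) c m] at hcm
    refine or_iff_not_imp_right.mpr fun hm => ?_
    have h : algebraMap _ (FractionRing (MvPolynomial ι k)) c = 0 := by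
      by_contra hc
      exact hm (by rw [← inv_smul_smul₀ hc m, hcm, smul_zero])
    exact (IsFractionRing.injective _ (FractionRing (MvPolynomial ι k))) (by rw [h, map_zero])
  · intro z hz
    rw [hD, ← LinearMap.mem_ker, Submodule.ker_mkQ]
    exact Submodule.subset_span ⟨z, hz, rfl⟩

/-- Enlarge the family to a transcendence basis, which has as many elements as there are variables.
Each variable is algebraic over it, so its gradients span the whole space; a spanning family of this
size is independent. -/
theorem linearIndependent_gradient [Finite ι] {κ : Type*} {x : κ → MvPolynomial ι k}
    (hx : AlgebraicIndependent k x) :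
    LinearIndependent (FractionRing (MvPolynomial ι k)) (fun j => gradient k ι (x j)) := by
  classical
  have := Fintype.ofFinite ι
  obtain ⟨t, hxt, ht⟩ := exists_isTranscendenceBasis_superset hx.coe_range
  have hcard := (ht.lift_cardinalMk_eq (IsTranscendenceBasis.mvPolynomial ι k))
  have hfin : Finite t := by
    rw [← Cardinal.lt_aleph0_iff_finite, ← Cardinal.lift_lt_aleph0, hcard, Cardinal.lift_lt_aleph0]
    exact Cardinal.mk_lt_aleph0
  have := Fintype.ofFinite t
  have hli : LinearIndependent (FractionRing (MvPolynomial ι k))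
      (fun z : t => gradient k ι (z : MvPolynomial ι k)) := by
    refine linearIndependent_of_top_le_span_of_card_eq_finrank ?_ ?_
    · rw [← (Pi.basisFun (FractionRing (MvPolynomial ι k)) ι).span_eq, Submodule.span_le]
      rintro _ ⟨i, rfl⟩
      have h1 := ht.isAlgebraic.isAlgebraic (X i : MvPolynomial ι k)
      have h2 := gradient_mem_span_of_isAlgebraic h1
      rw [← Set.range_comp] at h2
      simpa [gradient, Function.comp_def] using h2
    · rw [Module.finrank_fintype_fun_eq_card]
      have := congrArg Cardinal.toNat hcard
      simpa using this
  exact hli.comp (fun j => ⟨x j, hxt ⟨j, rfl⟩⟩) (fun a b hab => hx.injective (Subtype.ext_iff.mp hab))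

/-- **Jacobian criterion**: the dimension of the algebra generated by polynomials in characteristic
zero is the rank of their gradients. -/
theorem ringKrullDim_quotient_ker_aeval [Finite ι] {σ : Type*} [Finite σ]
    (p : σ → MvPolynomial ι k) :
    ringKrullDim (MvPolynomial σ k ⧸ RingHom.ker (aeval p : MvPolynomial σ k →ₐ[k] _)) =
      (Module.finrank (FractionRing (MvPolynomial ι k))
        (Submodule.span (FractionRing (MvPolynomial ι k))
          (Set.range fun j => gradient k ι (p j))) : ℕ) := by
  let f : MvPolynomial σ k →ₐ[k] MvPolynomial ι k := aeval p
  change ringKrullDim (MvPolynomial σ k ⧸ RingHom.ker f) = _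
  have : (RingHom.ker f).IsPrime := RingHom.ker_isPrime f
  let φ : (MvPolynomial σ k ⧸ RingHom.ker f) →ₐ[k] MvPolynomial ι k := Ideal.kerLiftAlg f
  have hφ : Function.Injective φ := Ideal.kerLiftAlg_injective f
  -- Noether normalization: the Krull dimension is the number `s` of algebraically independent `z
  -- j`. The `p j` and the `z j` are algebraic over each other, so their gradients have the same
  -- span.
  obtain ⟨s, g, hg, hint⟩ :=
    exists_integral_inj_algHom_of_fg k (MvPolynomial σ k ⧸ RingHom.ker f)
  have hdim : ringKrullDim (MvPolynomial σ k ⧸ RingHom.ker f) = (s : ℕ) := by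
    let _ := g.toRingHom.toAlgebra
    have : Algebra.IsIntegral (MvPolynomial (Fin s) k) (MvPolynomial σ k ⧸ RingHom.ker f) :=
      ⟨hint⟩
    have : FaithfulSMul (MvPolynomial (Fin s) k) (MvPolynomial σ k ⧸ RingHom.ker f) :=
      (faithfulSMul_iff_algebraMap_injective _ _).mpr hg
    rw [ringKrullDim_eq_of_isIntegral (R := MvPolynomial (Fin s) k)]
    simp
  let z : Fin s → MvPolynomial ι k := fun j => φ (g (X j))
  have hz' : aeval z = φ.comp g := by ext j; simp [z]
  have hz : AlgebraicIndependent k z := by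
    rw [AlgebraicIndependent, hz']
    exact hφ.comp hg
  have hspan : Submodule.span (FractionRing (MvPolynomial ι k))
      (Set.range fun j => gradient k ι (p j)) = Submodule.span (FractionRing (MvPolynomial ι k))
      (Set.range fun j => gradient k ι (z j)) := by
    apply le_antisymm <;> rw [Submodule.span_le] <;> rintro _ ⟨j, rfl⟩
    · have : IsAlgebraic (Algebra.adjoin k (Set.range z)) (p j) := by
        obtain ⟨q, hq, hq0⟩ := hint (Ideal.Quotient.mk _ (X j))
        have hmem : ∀ a, φ (g a) ∈ Algebra.adjoin k (Set.range z) := by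
          intro a
          rw [Algebra.adjoin_range_eq_range_aeval, hz']
          exact ⟨a, rfl⟩
        let h : MvPolynomial (Fin s) k →+* Algebra.adjoin k (Set.range z) :=
          ((φ.comp g : MvPolynomial (Fin s) k →ₐ[k] MvPolynomial ι k) : _ →+* _).codRestrict
            (Algebra.adjoin k (Set.range z)) hmem
        refine IsIntegral.isAlgebraic ⟨q.map h, hq.map h, ?_⟩
        rw [Polynomial.eval₂_map]
        have h3 := congrArg φ hq0
        rw [map_zero] at h3
        have h4 := Polynomial.hom_eval₂ q (g : MvPolynomial (Fin s) k →+* _)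
          (φ : (MvPolynomial σ k ⧸ RingHom.ker f) →+* MvPolynomial ι k)
          (Ideal.Quotient.mk (RingHom.ker f) (X j))
        have h5 : φ (Ideal.Quotient.mk (RingHom.ker f) (X j)) = p j := by
          change f (X j) = p j
          simp [f]
        change φ _ = Polynomial.eval₂ _ (φ (Ideal.Quotient.mk (RingHom.ker f) (X j))) q at h4
        rw [h5] at h4
        exact h4.symm.trans h3
      have h := gradient_mem_span_of_isAlgebraic this
      rwa [← Set.range_comp] at h
    · have : z j ∈ Algebra.adjoin k (Set.range p) := by
        rw [Algebra.adjoin_range_eq_range_aeval]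
        obtain ⟨a, ha⟩ := Ideal.Quotient.mk_surjective (g (X j))
        refine ⟨a, ?_⟩
        change f a = φ _
        rw [← ha]
        rfl
      have h := gradient_mem_span_of_isAlgebraic (isAlgebraic_algebraMap
        (⟨z j, this⟩ : Algebra.adjoin k (Set.range p)))
      rwa [← Set.range_comp] at h
  rw [hdim, hspan, finrank_span_eq_card (linearIndependent_gradient hz), Fintype.card_fin]

end Jacobian

end CompartmentModel

/-! ### Rank at a general point and dimension of an image. -/

namespace CompartmentModel

open MvPolynomial

/-- A matrix over a field has as many independent rows as its rank. -/
theorem exists_linearIndependent_row_submatrix {K m n : Type*} [Field K] [Fintype m] [Fintype n]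
    (M : Matrix m n K) {d : ℕ} (hd : M.rank = d) :
    ∃ a : Fin d → m, LinearIndependent K (M.submatrix a id).row := by
  obtain ⟨κ, a, ha, hsp, hli⟩ := exists_linearIndependent' K M.row
  have : Finite κ := Finite.of_injective a ha
  have := Fintype.ofFinite κ
  have hcard : Fintype.card κ = d := by
    rw [← finrank_span_eq_card hli, hsp, ← hd, Matrix.rank_eq_finrank_span_row]
  let e := Fintype.equivFinOfCardEq hcard
  exact ⟨a ∘ e.symm, hli.comp _ e.symm.injective⟩

/-- A matrix over a field has a nonvanishing minor whose size is its rank. -/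
theorem exists_submatrix_det_ne_zero {K m n : Type*} [Field K] [Fintype m] [Fintype n]
    (M : Matrix m n K) :
    ∃ (a : Fin M.rank → m) (b : Fin M.rank → n), (M.submatrix a b).det ≠ 0 := by
  obtain ⟨a, ha⟩ := exists_linearIndependent_row_submatrix M rfl
  have hr : (M.submatrix a id).transpose.rank = M.rank := by
    rw [Matrix.rank_transpose, LinearIndependent.rank_matrix ha, Fintype.card_fin]
  obtain ⟨b, hb⟩ := exists_linearIndependent_row_submatrix _ hr
  refine ⟨a, b, ?_⟩
  have := Matrix.linearIndependent_rows_iff_isUnit.mp hb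
  rw [Matrix.isUnit_iff_isUnit_det, isUnit_iff_ne_zero] at this
  rw [← Matrix.det_transpose]
  exact this

theorem le_rank_of_submatrix_det_ne_zero {K m n : Type*} [Field K] [Fintype n]
    (M : Matrix m n K) {d : ℕ} (a : Fin d → m) (b : Fin d → n)
    (h : (M.submatrix a b).det ≠ 0) : d ≤ M.rank := by
  have := Matrix.rank_of_det_ne_zero h
  rw [Fintype.card_fin] at this
  rw [← this]
  exact Matrix.rank_submatrix_le M a b

theorem det_submatrix_map {R S m n : Type*} [CommRing R] [CommRing S] (J : Matrix m n R)
    (φ : R →+* S) {d : ℕ} (a : Fin d → m) (b : Fin d → n) :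
    ((J.map φ).submatrix a b).det = φ (J.submatrix a b).det := by
  rw [RingHom.map_det]
  rfl

/-- The rank of a matrix of polynomials at a sufficiently general point is its rank over the field
of rational functions. -/
theorem exists_forall_rank_map_eval_eq {k ι m n : Type*} [Field k] [Fintype m] [Fintype n]
    (J : Matrix m n (MvPolynomial ι k)) :
    ∃ f : MvPolynomial ι k, f ≠ 0 ∧ ∀ x, eval x f ≠ 0 →
      (J.map (eval x)).rank = (J.map (algebraMap _ (FractionRing (MvPolynomial ι k)))).rank := by
  obtain ⟨a, b, hab⟩ :=
    exists_submatrix_det_ne_zero (J.map (algebraMap _ (FractionRing (MvPolynomial ι k))))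
  rw [det_submatrix_map] at hab
  refine ⟨(J.submatrix a b).det, fun h => hab (by rw [h, map_zero]), fun x hx => le_antisymm ?_ ?_⟩
  -- A minor that is nonzero at `x` is a nonzero polynomial, so specialization never raises the
  -- rank. The chosen `f`, a maximal generic minor, prevents a drop.
  · obtain ⟨a', b', h⟩ := exists_submatrix_det_ne_zero (J.map (eval x))
    refine le_rank_of_submatrix_det_ne_zero _ a' b' ?_
    rw [det_submatrix_map] at h ⊢
    intro h0
    refine h ?_
    rw [(map_eq_zero_iff _ (IsFractionRing.injective _ _)).mp h0, map_zero]
  · refine le_rank_of_submatrix_det_ne_zero _ a b ?_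
    rwa [det_submatrix_map]

/-- The Jacobian matrix of a family of polynomials. -/
noncomputable def jacobian {k ι σ : Type*} [Field k] (p : σ → MvPolynomial ι k) :
    Matrix σ ι (MvPolynomial ι k) :=
  Matrix.of fun j i => pderiv i (p j)

/-- A polynomial `q` vanishes on the image exactly when its composite with `p` vanishes at every
point, which over an infinite field means that the composite is zero. -/
theorem vanishingIdeal_range_eval {k ι σ : Type*} [Field k] [Infinite k]
    (p : σ → MvPolynomial ι k) :
    vanishingIdeal k (Set.range fun (x : ι → k) (j : σ) => eval x (p j)) =
      RingHom.ker (aeval p : MvPolynomial σ k →ₐ[k] _) := by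
  ext q
  have h : ∀ x : ι → k, aeval (fun j => eval x (p j)) q = eval x (aeval p q) := by
    intro x
    have : (aeval (fun j => eval x (p j)) : MvPolynomial σ k →ₐ[k] k) =
        (aeval x : MvPolynomial ι k →ₐ[k] k).comp (aeval p) := by
      ext j
      simp [aeval_eq_eval]
    rw [this]
    simp [aeval_eq_eval]
  rw [mem_vanishingIdeal_iff, Set.forall_mem_range, RingHom.mem_ker]
  simp only [h]
  exact ⟨fun h0 => MvPolynomial.funext fun x => by rw [map_zero]; exact h0 x,
    fun h0 x => by
      have : aeval p q = 0 := h0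
      rw [this, map_zero]⟩

/-- The dimension of the image of a polynomial map is the rank of its Jacobian matrix at a
sufficiently general point. -/
theorem exists_forall_zariskiDim_range_eq_rank {ι σ : Type*} [Fintype ι] [Fintype σ]
    (p : σ → MvPolynomial ι ℂ) :
    ∃ f : MvPolynomial ι ℂ, f ≠ 0 ∧ ∀ x, eval x f ≠ 0 →
      zariskiDim (Set.range fun (x : ι → ℂ) (j : σ) => eval x (p j)) =
        (((jacobian p).map (eval x)).rank : ℕ) := by
  classical
  obtain ⟨f, hf, h⟩ := exists_forall_rank_map_eval_eq (jacobian p)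
  refine ⟨f, hf, fun x hx => ?_⟩
  rw [h x hx, zariskiDim, vanishingIdeal_range_eval, ringKrullDim_quotient_ker_aeval,
    Matrix.rank_eq_finrank_span_row]
  have : (fun j => gradient ℂ ι (p j)) =
      ((jacobian p).map (algebraMap _ (FractionRing (MvPolynomial ι ℂ)))).row := by
    funext j i
    exact gradient_apply (p j) i
  rw [this]

end CompartmentModel

/-! ### Markov parameters from the two characteristic polynomials. -/

namespace CompartmentModel

open Polynomial Matrix

section Markov

variable {V S : Type*} [Fintype V] [DecidableEq V] [CommRing S]

/-- The diagonal cofactor is the determinant of the characteristic matrix with row `r` replaced by a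
unit vector, which is block triangular with a `1 × 1` block at `r`. -/
theorem adjugate_charmatrix_apply_self (A : Matrix V V S) (r : V) :
    adjugate (charmatrix A) r r =
      (A.submatrix (Subtype.val : {v // v ≠ r} → V) Subtype.val).charpoly := by
  have : Subsingleton {i // ¬ (i ≠ r)} :=
    ⟨fun a b => Subtype.ext ((not_not.mp a.2).trans (not_not.mp b.2).symm)⟩
  rw [adjugate_apply, twoBlockTriangular_det _ (fun i => i ≠ r),
    det_eq_elem_of_subsingleton _ (⟨r, not_not.mpr rfl⟩ : {i // ¬ (i ≠ r)})]
  · rw [toSquareBlockProp_def, toSquareBlockProp_def, of_apply, updateRow_self, Pi.single_eq_same,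
      mul_one, charpoly]
    congr 1
    ext i j : 1
    simp [charmatrix_apply, updateRow_ne i.2, diagonal_apply, Subtype.ext_iff]
  · intro i hi j hj
    obtain rfl := not_not.mp hi
    simp [hj]

/-- Comparing coefficients of `λ` in this identity gives the Faddeev-LeVerrier recursion for the
coefficient matrices of the adjugate. -/
theorem matPolyEquiv_adjugate_charmatrix_mul (A : Matrix V V S) :
    matPolyEquiv (adjugate (charmatrix A)) * (X - C A) =
      A.charpoly.map (algebraMap S (Matrix V V S)) := by
  have h : A.charpoly • (1 : Matrix V V S[X]) = adjugate (charmatrix A) * charmatrix A :=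
    (adjugate_mul _).symm
  apply_fun matPolyEquiv at h
  rw [map_mul, matPolyEquiv_charmatrix, matPolyEquiv_smul_one] at h
  exact h.symm

theorem coeff_matPolyEquiv_adjugate_charmatrix [Nontrivial S] [Nonempty V] (A : Matrix V V S) :
    (matPolyEquiv (adjugate (charmatrix A))).coeff (Fintype.card V - 1) = 1 := by
  have h := matPolyEquiv_adjugate_charmatrix_mul A
  have hm : (A.charpoly.map (algebraMap S (Matrix V V S))).Monic := (charpoly_monic A).map _
  have hd : (A.charpoly.map (algebraMap S (Matrix V V S))).natDegree = Fintype.card V := by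
    rw [(charpoly_monic A).natDegree_map, charpoly_natDegree_eq_dim]
  rw [← h] at hm hd
  have hQ := Monic.of_mul_monic_right (monic_X_sub_C A) hm
  rw [hQ.natDegree_mul (monic_X_sub_C A), natDegree_X_sub_C] at hd
  rw [← hd]
  exact hQ.coeff_natDegree

/-- The characteristic polynomials of `A` and of `A` with the vertex `r` deleted determine the
Markov parameters `(A ^ k) r r`. -/
theorem pow_apply_self_eq_of_charpoly_eq {A A' : Matrix V V S} {r : V}
    (h : A.charpoly = A'.charpoly)
    (h' : (A.submatrix (Subtype.val : {v // v ≠ r} → V) Subtype.val).charpoly =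
      (A'.submatrix (Subtype.val : {v // v ≠ r} → V) Subtype.val).charpoly) (k : ℕ) :
    (A ^ k) r r = (A' ^ k) r r := by
  nontriviality S
  have : Nonempty V := ⟨r⟩
  let Q : Matrix V V S → ℕ → Matrix V V S := fun A j =>
    (matPolyEquiv (adjugate (charmatrix A))).coeff j
  have hQ0 : ∀ A : Matrix V V S, - (Q A 0 * A) = A.charpoly.coeff 0 • (1 : Matrix V V S) := by
    intro A
    have := congrArg (fun q => q.coeff 0) (matPolyEquiv_adjugate_charmatrix_mul A)
    simpa [mul_sub, Algebra.algebraMap_eq_smul_one] using this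
  have hQs : ∀ (A : Matrix V V S) (j : ℕ),
      Q A j - Q A (j + 1) * A = A.charpoly.coeff (j + 1) • (1 : Matrix V V S) := by
    intro A j
    have := congrArg (fun q => q.coeff (j + 1)) (matPolyEquiv_adjugate_charmatrix_mul A)
    simpa [mul_sub, Algebra.algebraMap_eq_smul_one] using this
  have step0 : ∀ (A : Matrix V V S) (i : ℕ),
      (Q A 0 * A ^ (i + 1)) r r = - (A.charpoly.coeff 0 * (A ^ i) r r) := by
    intro A i
    have := congrArg (fun M => (M * A ^ i) r r) (hQ0 A)
    simp only [neg_mul, smul_mul_assoc, one_mul, Matrix.neg_apply, Matrix.smul_apply, smul_eq_mul,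
      mul_assoc, ← pow_succ'] at this
    rw [← this, neg_neg]
  have steps : ∀ (A : Matrix V V S) (i j : ℕ), (Q A (j + 1) * A ^ (i + 1)) r r =
      (Q A j * A ^ i) r r - A.charpoly.coeff (j + 1) * (A ^ i) r r := by
    intro A i j
    have := congrArg (fun M => (M * A ^ i) r r) (hQs A j)
    simp only [sub_mul, smul_mul_assoc, one_mul, Matrix.sub_apply, Matrix.smul_apply, smul_eq_mul,
      mul_assoc, ← pow_succ'] at this
    rw [← this]
    ring
  -- The induction needs all the `(Q_j A ^ i) r r` at once. For `i = 0` they are coefficients of the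
  -- characteristic polynomial with `r` deleted, and the recursion passes from `i` to `i + 1`. Since
  -- the top coefficient of the adjugate is `1`, the case `j = n - 1` is `(A ^ i) r r`.
  have key : ∀ i j, (Q A j * A ^ i) r r = (Q A' j * A' ^ i) r r := by
    intro i
    induction i with
    | zero =>
      intro j
      simp only [Q, pow_zero, mul_one, matPolyEquiv_coeff_apply]
      rw [adjugate_charmatrix_apply_self, adjugate_charmatrix_apply_self, h']
    | succ i ih =>
      have hi : (A ^ i) r r = (A' ^ i) r r := by
        have := ih (Fintype.card V - 1)
        simpa [Q, coeff_matPolyEquiv_adjugate_charmatrix] using this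
      intro j
      cases j with
      | zero => rw [step0, step0, h, hi]
      | succ j => rw [steps, steps, h, hi, ih]
  have := key k (Fintype.card V - 1)
  simpa [Q, coeff_matPolyEquiv_adjugate_charmatrix] using this

end Markov

end CompartmentModel

/-! ### First-order deformations and commutators. -/

namespace CompartmentModel

open Polynomial Matrix

variable {V : Type*} [Fintype V] [DecidableEq V]

/-- The matrix `A + ε B` over the dual numbers. -/
def perturb {V : Type*} (A B : Matrix V V ℂ) : Matrix V V (DualNumber ℂ) :=
  of fun i j => TrivSqZeroExt.inl (A i j) + TrivSqZeroExt.inr (B i j)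

@[simp]
theorem fst_perturb {V : Type*} (A B : Matrix V V ℂ) (i j : V) : (perturb A B i j).fst = A i j := by
  simp [perturb]

@[simp]
theorem snd_perturb {V : Type*} (A B : Matrix V V ℂ) (i j : V) : (perturb A B i j).snd = B i j := by
  simp [perturb]

theorem perturb_mul_perturb {V : Type*} [Fintype V] (A B A' B' : Matrix V V ℂ) :
    perturb A B * perturb A' B' = perturb (A * A') (A * B' + B * A') := by
  ext i j
  · simp [mul_apply, TrivSqZeroExt.fst_sum]
  · simp [mul_apply, TrivSqZeroExt.snd_sum, Finset.sum_add_distrib]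

theorem perturb_one_zero {V : Type*} [DecidableEq V] : perturb (1 : Matrix V V ℂ) 0 = 1 := by
  ext i j <;> by_cases h : i = j <;> simp [h, one_apply]

/-- Over the dual numbers, `A + ε[X, A]` is the conjugate of `A` by `1 + εX`, whose inverse is `1 -
εX`. -/
theorem charpoly_perturb_commutator (A X : Matrix V V ℂ) :
    (perturb A (X * A - A * X)).charpoly = (perturb A 0).charpoly := by
  have h1 : perturb 1 X * perturb 1 (-X) = 1 := by
    rw [perturb_mul_perturb]
    simp [perturb_one_zero]
  have h2 : perturb 1 (-X) * perturb 1 X = 1 := by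
    rw [perturb_mul_perturb]
    simp [perturb_one_zero]
  have h : perturb A (X * A - A * X) = perturb 1 X * perturb A 0 * perturb 1 (-X) := by
    rw [perturb_mul_perturb, perturb_mul_perturb]
    congr 1 <;> simp [sub_eq_neg_add]
  rw [h, charpoly_mul_comm, ← mul_assoc, h2, one_mul]

/-- In each matrix product the summand indexed by `r` contains an entry of row or column `r` of `X`,
so deleting `r` commutes with forming the commutator. -/
theorem submatrix_commutator {A X : Matrix V V ℂ} {r : V} (hX : ∀ i, X r i = 0 ∧ X i r = 0) :
    (X * A - A * X).submatrix (Subtype.val : {v // v ≠ r} → V) (Subtype.val : {v // v ≠ r} → V) =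
      X.submatrix (Subtype.val : {v // v ≠ r} → V) (Subtype.val : {v // v ≠ r} → V) *
        A.submatrix (Subtype.val : {v // v ≠ r} → V) (Subtype.val : {v // v ≠ r} → V) -
      A.submatrix (Subtype.val : {v // v ≠ r} → V) (Subtype.val : {v // v ≠ r} → V) *
        X.submatrix (Subtype.val : {v // v ≠ r} → V) (Subtype.val : {v // v ≠ r} → V) := by
  have key : ∀ f : V → ℂ, f r = 0 → ∑ v, f v = ∑ v : {v // v ≠ r}, f v := by
    intro f hf
    rw [Fintype.sum_eq_add_sum_subtype_ne f r, hf, zero_add]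
  ext i j
  simp only [Matrix.sub_apply, submatrix_apply, mul_apply]
  rw [key _ (by rw [(hX _).2, zero_mul]), key _ (by rw [(hX _).1, mul_zero])]

/-- The pair `(A, e_r)` is controllable: `e_r` is a cyclic vector of `A`. -/
def Controllable (r : V) (A : Matrix V V ℂ) : Prop :=
  ∀ q : ℂ[X], q.natDegree < Fintype.card V → (aeval A q) *ᵥ Pi.single r 1 = 0 → q = 0

/-- Polynomials of degree below `n` form a space of dimension `n`, so injectivity of `q ↦ q(A) e_r`
on it forces surjectivity. -/
theorem Controllable.exists_aeval_mulVec {r : V} {A : Matrix V V ℂ} (hA : Controllable r A)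
    (x : V → ℂ) : ∃ q : ℂ[X], (aeval A q) *ᵥ Pi.single r 1 = x := by
  let F : degreeLT ℂ (Fintype.card V) →ₗ[ℂ] (V → ℂ) :=
    ((mulVecBilin ℂ ℂ).flip (Pi.single r 1) ∘ₗ (aeval A).toLinearMap) ∘ₗ Submodule.subtype _
  have hF : ∀ q, F q = (aeval A (q : ℂ[X])) *ᵥ Pi.single r 1 := fun q => rfl
  have hinj : Function.Injective F := by
    rw [injective_iff_map_eq_zero]
    intro q hq
    have : Nonempty V := ⟨r⟩
    refine Subtype.ext (hA q ?_ hq)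
    have := mem_degreeLT.mp q.2
    by_cases h0 : (q : ℂ[X]) = 0
    · rw [h0, natDegree_zero]
      exact Fintype.card_pos
    · exact (natDegree_lt_iff_degree_lt h0).mpr this
  have hsurj : Function.Surjective F := by
    refine (LinearMap.injective_iff_surjective_of_finrank_eq_finrank ?_).mp hinj
    rw [(degreeLTEquiv ℂ (Fintype.card V)).finrank_eq]
    simp
  obtain ⟨q, hq⟩ := hsurj x
  exact ⟨q, hq⟩

/-- If `X` commutes with `A` and kills `e_r`, it kills every `q(A) e_r`, hence everything. -/
theorem Controllable.eq_zero_of_commute {r : V} {A X : Matrix V V ℂ} (hA : Controllable r A)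
    (hX : ∀ i, X i r = 0) (hXA : X * A - A * X = 0) : X = 0 := by
  have hc : Commute X A := sub_eq_zero.mp hXA
  refine ext_of_mulVec_single fun i => ?_
  obtain ⟨q, hq⟩ := hA.exists_aeval_mulVec (Pi.single i 1)
  have hcq : Commute X (aeval A q) := by
    rw [aeval_eq_sum_range]
    exact Commute.sum_right _ _ _ fun k _ => (hc.pow_right k).smul_right _
  have h0 : X *ᵥ Pi.single r 1 = 0 := by
    ext j
    simp [hX]
  rw [← hq, mulVec_mulVec, hcq.eq, ← mulVec_mulVec, h0, mulVec_zero, zero_mulVec]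

/-- A first-order deformation of a controllable matrix `A` that preserves both characteristic
polynomials is a commutator of `A` with a matrix whose row and column at `r` vanish. -/
theorem Controllable.exists_commutator {r : V} {A B : Matrix V V ℂ} (hA : Controllable r A)
    (h : (perturb A B).charpoly = (perturb A 0).charpoly)
    (h' : ((perturb A B).submatrix (Subtype.val : {v // v ≠ r} → V) Subtype.val).charpoly =
      ((perturb A 0).submatrix (Subtype.val : {v // v ≠ r} → V) Subtype.val).charpoly) :
    ∃ X : Matrix V V ℂ, (∀ i, X r i = 0 ∧ X i r = 0) ∧ X * A - A * X = B := by
  have hnonempty : Nonempty V := ⟨r⟩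
  let fstM : Matrix V V (DualNumber ℂ) →ₐ[ℂ] Matrix V V ℂ :=
    (TrivSqZeroExt.fstHom ℂ ℂ ℂ).mapMatrix
  let inlM : Matrix V V ℂ →ₐ[ℂ] Matrix V V (DualNumber ℂ) :=
    (TrivSqZeroExt.inlAlgHom ℂ ℂ ℂ).mapMatrix
  have hinl : inlM A = perturb A 0 := by
    ext i j <;> simp [inlM, perturb]
  have hfst : ∀ B : Matrix V V ℂ, fstM (perturb A B) = A := by
    intro B
    ext i j
    simp [fstM]
  -- `F q = q(A) e_r`, and `T q` below is the `ε`-part of `q(A + εB) e_r`. The matrix sought is the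
  -- unique `Y` with `Y (F q) = T q` for all `q`.
  let F : ℂ[X] →ₗ[ℂ] (V → ℂ) :=
    (mulVecBilin ℂ ℂ).flip (Pi.single r 1) ∘ₗ (aeval A).toLinearMap
  have hF : ∀ q i, F q i = aeval A q i r := by
    intro q i
    simp [F]
  let T : ℂ[X] →ₗ[ℂ] (V → ℂ) :=
    { toFun := fun q i => (aeval (perturb A B) q i r).snd
      map_add' := fun p q => by ext i; simp
      map_smul' := fun c q => by ext i; simp }
  have hT : ∀ q i, T q i = (aeval (perturb A B) q i r).snd := fun _ _ => rfl
  have hfstF : ∀ q i, (aeval (perturb A B) q i r).fst = F q i := by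
    intro q i
    have h1 := aeval_algHom_apply fstM (perturb A B) q
    rw [hfst] at h1
    rw [hF, h1]
    rfl
  have hχ : aeval (perturb A B) A.charpoly = 0 := by
    have h1 : (perturb A B).charpoly = A.charpoly.map (algebraMap ℂ (DualNumber ℂ)) := by
      rw [h, ← hinl, ← charpoly_map]
      rfl
    rw [← aeval_map_algebraMap (DualNumber ℂ), ← h1, aeval_self_charpoly]
  -- By controllability `F q = 0` makes `q` a multiple of the characteristic polynomial of `A`,
  -- which by hypothesis is also that of `A + εB` and so annihilates it.
  have hFT : ∀ q, F q = 0 → T q = 0 := by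
    intro q hq
    have hq' := modByMonic_add_div q A.charpoly
    have hm : q %ₘ A.charpoly = 0 := by
      refine hA _ ?_ ?_
      · rw [← A.charpoly_natDegree_eq_dim]
        refine natDegree_modByMonic_lt _ A.charpoly_monic ?_
        intro h1
        have := A.charpoly_natDegree_eq_dim
        rw [h1, natDegree_one] at this
        exact Fintype.card_ne_zero this.symm
      · rw [modByMonic_eq_sub_mul_div q A.charpoly, map_sub, map_mul, aeval_self_charpoly, zero_mul,
          sub_zero]
        exact hq
    rw [← hq', hm, zero_add]
    ext i
    rw [hT, map_mul, hχ, zero_mul]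
    rfl
  have hsurj : ∀ x, ∃ q, F q = x := hA.exists_aeval_mulVec
  choose q hq using fun v : V => hsurj (Pi.single v 1)
  let Y : Matrix V V ℂ := of fun i v => T (q v) i
  have hY : ∀ p, Y *ᵥ F p = T p := by
    intro p
    have h1 : F (∑ v, F p v • q v) = F p := by
      rw [map_sum]
      simp only [map_smul, hq]
      exact (pi_eq_sum_univ' (F p)).symm
    have h2 := hFT (p - ∑ v, F p v • q v) (by rw [map_sub, h1, sub_self])
    rw [map_sub, sub_eq_zero, map_sum] at h2
    rw [h2]
    ext i
    simp [Y, mulVec, dotProduct, mul_comm]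
  refine ⟨Y, fun i => ⟨?_, ?_⟩, ?_⟩
  · have h1 := congrFun (hY (q i)) r
    rw [hq, mulVec_single_one] at h1
    change Y r i = _ at h1
    rw [h1, hT]
    -- Equality of the Markov parameters over the dual numbers: the `(r, r)` entry of `p(A + εB)`
    -- has no `ε`-part, so row `r` of `Y` vanishes.
    have h2 : ∀ p : ℂ[X], aeval (perturb A B) p r r = aeval (perturb A 0) p r r := by
      intro p
      rw [aeval_eq_sum_range, aeval_eq_sum_range]
      simp only [Matrix.sum_apply, Matrix.smul_apply, pow_apply_self_eq_of_charpoly_eq h h']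
    rw [h2, ← hinl, aeval_algHom_apply]
    simp [inlM]
  · have h1 := congrFun (hY 1) i
    have h2 : F 1 = Pi.single r 1 := by
      ext j
      rw [hF, map_one, one_apply, Pi.single_apply]
    rw [h2, mulVec_single_one] at h1
    change Y i r = _ at h1
    rw [h1, hT, map_one, one_apply]
    split_ifs <;> simp
  · have h1 : ∀ p, F (X * p) = A *ᵥ F p := by
      intro p
      ext i
      rw [hF, map_mul, aeval_X]
      simp [mul_apply, mulVec, dotProduct, hF]
    -- The `ε`-part of `(A + εB) p(A + εB) e_r`. Compared with `F (X * p) = A (F p)`, it says that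
    -- `Y A = A Y + B` on every `F p`.
    have h2 : ∀ p, T (X * p) = A *ᵥ T p + B *ᵥ F p := by
      intro p
      ext i
      rw [hT, map_mul, aeval_X]
      simp [mul_apply, mulVec, dotProduct, hT, TrivSqZeroExt.snd_sum, Finset.sum_add_distrib,
        hfstF]
    have h3 : ∀ x, (Y * A - A * Y) *ᵥ x = B *ᵥ x := by
      intro x
      obtain ⟨p, rfl⟩ := hsurj x
      rw [sub_mulVec, ← mulVec_mulVec, ← mulVec_mulVec, ← h1, hY, hY, h2, add_sub_cancel_left]
    exact ext_of_mulVec_single fun i => h3 _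

end CompartmentModel

/-! ### Controllability from a spanning tree. -/

namespace CompartmentModel

/-- There is a path of length `k` from `r` to the given vertex. -/
def ReachableIn {V : Type*} (R : V → V → Prop) (r : V) : ℕ → V → Prop
  | 0, v => v = r
  | k + 1, v => ∃ u, ReachableIn R r k u ∧ R u v

/-- A breadth-first spanning tree of a connected relation, rooted at `r`. -/
theorem exists_depth_parent {V : Type*} {R : V → V → Prop} (r : V)
    (h : ∀ v, Relation.ReflTransGen R r v) :
    ∃ (d : V → ℕ) (p : V → V), (∀ v, d v = 0 ↔ v = r) ∧
      ∀ v, v ≠ r → R (p v) v ∧ d (p v) + 1 = d v := by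
  classical
  have hS : ∀ v, ∃ k, ReachableIn R r k v := by
    intro v
    induction h v with
    | refl => exact ⟨0, rfl⟩
    | tail _ hbc ih =>
      obtain ⟨k, hk⟩ := ih
      exact ⟨k + 1, _, hk, hbc⟩
  have hmin : ∀ v, ∃ k, ReachableIn R r k v ∧ ∀ j, ReachableIn R r j v → k ≤ j := fun v =>
    ⟨_, Nat.find_spec (hS v), fun _ => Nat.find_min' (hS v)⟩
  choose d hd hmin using hmin
  have h0 : ∀ v, d v = 0 ↔ v = r := by
    refine fun v => ⟨fun h => ?_, fun h => Nat.le_zero.mp (hmin v 0 h)⟩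
    have := hd v
    rwa [h] at this
  have hp : ∀ v, ∃ u, v ≠ r → R u v ∧ d u + 1 = d v := by
    intro v
    by_cases hv : v = r
    · exact ⟨v, fun h => absurd hv h⟩
    · obtain ⟨k, hk⟩ := Nat.exists_eq_succ_of_ne_zero (mt (h0 v).mp hv)
      have hspec := hd v
      rw [hk] at hspec
      obtain ⟨u, hu, huv⟩ := hspec
      refine ⟨u, fun _ => ⟨huv, ?_⟩⟩
      have h1 : d u ≤ k := hmin u k hu
      have h2 : d v ≤ d u + 1 := hmin v (d u + 1) ⟨u, hd u, huv⟩
      omega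
  choose p hp using hp
  exact ⟨d, p, h0, hp⟩

open Polynomial Matrix

variable {V : Type*} [Fintype V] [DecidableEq V]

/-- A matrix supported on the diagonal, with distinct entries, and on a spanning tree rooted at `r`
is controllable from `r`. -/
theorem controllable_diagonal_add_tree {r : V} {d : V → ℕ} {p : V → V} {a : V → ℂ}
    (ha : Function.Injective a) (hd : ∀ v, d v = 0 ↔ v = r)
    (hp : ∀ v, v ≠ r → d (p v) + 1 = d v) :
    Controllable r (diagonal a + of fun i j => if i ≠ r ∧ j = p i then (1 : ℂ) else 0) := by
  set A : Matrix V V ℂ := diagonal a + of fun i j => if i ≠ r ∧ j = p i then (1 : ℂ) else 0 with hA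
  have hmul : ∀ (M : Matrix V V ℂ) (i j : V),
      (A * M) i j = a i * M i j + if i = r then 0 else M (p i) j := by
    intro M i j
    rw [hA, add_mul, Matrix.add_apply, diagonal_mul, mul_apply]
    by_cases hi : i = r <;> simp [hi]
  -- Each factor of `A` climbs at most one tree edge, so a vertex at depth `d i` is linked to `r` by
  -- no power below `d i`, and by the tree path alone at power `d i`.
  have hpow : ∀ k i, k ≤ d i → (A ^ k) i r = if d i = k then 1 else 0 := by
    intro k
    induction k with
    | zero => intro i _; simp [one_apply, hd]
    | succ k ih =>
      intro i hi
      have hir : i ≠ r := fun h => by have := (hd i).mpr h; omega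
      have h1 := hp i hir
      rw [pow_succ', hmul, ih i (by omega), ih (p i) (by omega), if_neg (by omega), if_neg hir,
        mul_zero, zero_add]
      by_cases h : d i = k + 1
      · rw [if_pos (by omega), if_pos h]
      · rw [if_neg (by omega), if_neg h]
  have hmonic : ∀ (P : ℂ[X]) (i : V), P.Monic → P.natDegree = d i → aeval A P i r = 1 := by
    intro P i hP hPd
    rw [aeval_eq_sum_range, Matrix.sum_apply, Finset.sum_range_succ, Finset.sum_eq_zero, zero_add]
    · rw [hP.coeff_natDegree, one_smul, hPd, hpow _ _ le_rfl, if_pos rfl]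
    · intro k hk
      rw [Finset.mem_range] at hk
      rw [Matrix.smul_apply, hpow _ _ (by omega), if_neg (by omega), smul_zero]
  have hlin : ∀ (M : Matrix V V ℂ) (i j : V),
      (aeval A (X - C (a i)) * M) i j = if i = r then 0 else M (p i) j := by
    intro M i j
    rw [map_sub, aeval_X, aeval_C, sub_mul, Matrix.sub_apply, hmul, Algebra.algebraMap_eq_smul_one,
      smul_mul_assoc, one_mul, Matrix.smul_apply, smul_eq_mul, add_sub_cancel_left]
  -- Here `P` is the product of `X - a u` over the proper ancestors `u` of `i`. Row `i` of `P(A)` is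
  -- a left eigenvector of `A` for `a i`, with entry `1` at `r` by `hmonic`.
  have hex : ∀ (n : ℕ) (i : V), d i = n → ∃ P : ℂ[X], P.Monic ∧ P.natDegree = d i ∧
      ∀ j, aeval A ((X - C (a i)) * P) i j = 0 := by
    intro n
    induction n with
    | zero =>
      intro i hi
      have hir := (hd i).mp hi
      refine ⟨1, monic_one, by rw [hi, natDegree_one], fun j => ?_⟩
      rw [map_mul, hlin, if_pos hir]
    | succ n ih =>
      intro i hi
      have hir : i ≠ r := fun h => by have := (hd i).mpr h; omega
      have h1 := hp i hir
      obtain ⟨P, hP, hPd, hPj⟩ := ih (p i) (by omega)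
      refine ⟨(X - C (a (p i))) * P, (monic_X_sub_C _).mul hP, ?_, fun j => ?_⟩
      · rw [(monic_X_sub_C _).natDegree_mul hP, natDegree_X_sub_C]
        omega
      · rw [map_mul, hlin, if_neg hir, hPj]
  intro q hq hq0
  -- Pairing the left eigenvector for `a i` with `q(A) e_r = 0` gives `q(a i) = 0`, so `q` has more
  -- distinct roots than its degree allows.
  refine eq_zero_of_natDegree_lt_card_of_eval_eq_zero q ha (fun i => ?_) hq
  obtain ⟨P, hP, hPd, hPj⟩ := hex _ i rfl
  have h1 : aeval A (P * q) i r = 0 := by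
    rw [map_mul, mul_apply]
    refine Finset.sum_eq_zero fun j _ => ?_
    have hj : aeval A q j r = 0 := by
      have := congrFun hq0 j
      rwa [mulVec_single_one] at this
    rw [hj, mul_zero]
  have h2 : P * q = (X - C (a i)) * P * (q /ₘ (X - C (a i))) + C (q.eval (a i)) * P := by
    conv_lhs => rw [← modByMonic_add_div q (X - C (a i)), modByMonic_X_sub_C_eq_C_eval]
    ring
  have h3 : aeval A ((X - C (a i)) * P * (q /ₘ (X - C (a i)))) i r = 0 := by
    rw [map_mul, mul_apply]
    exact Finset.sum_eq_zero fun j _ => by rw [hPj, zero_mul]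
  rw [h2, map_add, Matrix.add_apply, h3, zero_add, map_mul, aeval_C,
    Algebra.algebraMap_eq_smul_one, smul_mul_assoc, one_mul, Matrix.smul_apply,
    hmonic P i hP hPd, smul_eq_mul, mul_one] at h1
  exact h1

theorem exists_controllable {G : Digraph V} (hconn : StronglyConnected G) (r : V) :
    ∃ A ∈ parameterSpace G, Controllable r A := by
  obtain ⟨d, p, hd, hp⟩ := exists_depth_parent r (hconn r)
  let a : V → ℂ := fun v => ((Fintype.equivFin V v : ℕ) : ℂ)
  have ha : Function.Injective a := fun u v h =>
    (Fintype.equivFin V).injective (Fin.ext (Nat.cast_injective h))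
  refine ⟨_, ?_, controllable_diagonal_add_tree ha hd fun v hv => (hp v hv).2⟩
  intro i j hij hG
  rw [Matrix.add_apply, diagonal_apply_ne _ hij, zero_add, of_apply, if_neg]
  rintro ⟨hi, rfl⟩
  exact hG (hp i hi).1

/-- The columns of this matrix are the first iterates of `e_r` under `A`. -/
def controllabilityMatrix {S : Type*} [CommRing S] (r : V) (A : Matrix V V S) :
    Matrix V (Fin (Fintype.card V)) S :=
  of fun i k => (A ^ (k : ℕ)) i r

/-- Expresses controllability as the nonvanishing of a polynomial in the entries of `A`, so that one
controllable matrix makes it generic. -/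
theorem controllable_iff_det_ne_zero (r : V) (A : Matrix V V ℂ) :
    Controllable r A ↔
      ((controllabilityMatrix r A).submatrix id (Fintype.equivFin V)).det ≠ 0 := by
  have hmulVec : ∀ q : ℂ[X], q.natDegree < Fintype.card V →
      (aeval A q) *ᵥ Pi.single r 1 =
        (controllabilityMatrix r A).submatrix id (Fintype.equivFin V) *ᵥ
          fun v => q.coeff (Fintype.equivFin V v) := by
    intro q hq
    ext i
    rw [mulVec_single_one, col_apply, aeval_eq_sum_range' hq, Matrix.sum_apply,
      ← Fin.sum_univ_eq_sum_range (fun k => (q.coeff k • A ^ k) i r),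
      ← (Fintype.equivFin V).sum_comp]
    simp [mulVec, dotProduct, controllabilityMatrix, mul_comm]
  rw [Ne, ← exists_mulVec_eq_zero_iff, not_exists]
  constructor
  · rintro hA c ⟨hc, hc0⟩
    let q : ℂ[X] := ∑ v, monomial (Fintype.equivFin V v : ℕ) (c v)
    have hcoeff : ∀ v, q.coeff (Fintype.equivFin V v) = c v := by
      intro v
      simp only [q, finsetSum_coeff, coeff_monomial]
      rw [Finset.sum_eq_single v]
      · simp
      · intro u _ huv
        rw [if_neg]
        exact fun h => huv ((Fintype.equivFin V).injective (Fin.ext h))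
      · simp
    have hq : q.natDegree < Fintype.card V := by
      have hpos : 0 < Fintype.card V := Fintype.card_pos_iff.mpr ⟨r⟩
      refine lt_of_le_of_lt (natDegree_sum_le_of_forall_le (n := Fintype.card V - 1) _ _ ?_) (by omega)
      intro v _
      refine (natDegree_monomial_le _).trans ?_
      have := (Fintype.equivFin V v).2
      omega
    refine hc (funext fun v => ?_)
    rw [← hcoeff v, hA q hq (by rw [hmulVec q hq, funext hcoeff, hc0])]
    simp
  · intro h q hq hq0
    rw [hmulVec q hq] at hq0
    have h1 := not_and'.mp (h _) hq0
    ext k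
    rw [not_not] at h1
    by_cases hk : k < Fintype.card V
    · simpa using congrFun h1 ((Fintype.equivFin V).symm ⟨k, hk⟩)
    · rw [coeff_eq_zero_of_natDegree_lt (by omega), coeff_zero]

end CompartmentModel

/-! ### Coordinates on the parameter space and the kernel of the Jacobian. -/

namespace CompartmentModel

open MvPolynomial Matrix

section Parameters

variable {V : Type*} (G : Digraph V)

/-- The positions of the free entries of the matrices in `parameterSpace G`. -/
abbrev Position : Type _ := {e : V × V // e.1 = e.2 ∨ G.Adj e.2 e.1}

noncomputable instance [Finite V] : Fintype (Position G) := Fintype.ofFinite _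

theorem card_position [Finite V] (hloop : ∀ v : V, ¬ G.Adj v v) :
    Fintype.card (Position G) = Nat.card V + numEdges G := by
  have h1 : {e : V × V | e.1 = e.2 ∨ G.Adj e.2 e.1} =
      (fun v => (v, v)) '' Set.univ ∪ Prod.swap '' {e : V × V | G.Adj e.1 e.2} := by
    ext ⟨i, j⟩
    simp [eq_comm]
  have h2 : Disjoint ((fun v => (v, v)) '' (Set.univ : Set V))
      (Prod.swap '' {e : V × V | G.Adj e.1 e.2}) := by
    rw [Set.disjoint_left]
    rintro _ ⟨v, -, rfl⟩ ⟨⟨i, j⟩, h, h'⟩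
    simp only [Prod.swap_prod_mk, Prod.mk.injEq] at h'
    obtain ⟨rfl, rfl⟩ := h'
    exact hloop _ h
  rw [← Nat.card_eq_fintype_card]
  change Nat.card {e : V × V | e.1 = e.2 ∨ G.Adj e.2 e.1} = _
  rw [Nat.card_coe_set_eq, h1, Set.ncard_union_eq h2,
    Set.ncard_image_of_injective _ (fun u v h => (Prod.mk.inj h).1),
    Set.ncard_image_of_injective _ Prod.swap_injective, Set.ncard_univ, numEdges]

variable {G}

open Classical in
/-- The matrix with given entries at the free positions. -/
noncomputable def ofParameters {S : Type*} [Zero S] (x : Position G → S) : Matrix V V S :=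
  of fun i j => if h : i = j ∨ G.Adj j i then x ⟨(i, j), h⟩ else 0

theorem ofParameters_apply {S : Type*} [Zero S] (x : Position G → S) (e : Position G) :
    ofParameters x e.1.1 e.1.2 = x e := by
  rw [ofParameters, of_apply, dif_pos e.2]

theorem ofParameters_apply_of_not {S : Type*} [Zero S] (x : Position G → S) {i j : V}
    (h : ¬ (i = j ∨ G.Adj j i)) : ofParameters x i j = 0 := by
  rw [ofParameters, of_apply, dif_neg h]

theorem ofParameters_map {S T : Type*} [CommRing S] [CommRing T] (φ : S →+* T)
    (x : Position G → S) : (ofParameters x).map φ = ofParameters fun e => φ (x e) := by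
  ext i j
  by_cases h : i = j ∨ G.Adj j i
  · rw [map_apply, ofParameters_apply x ⟨(i, j), h⟩, ofParameters_apply _ ⟨(i, j), h⟩]
  · rw [map_apply, ofParameters_apply_of_not _ h, ofParameters_apply_of_not _ h, map_zero]

theorem ofParameters_mem (x : Position G → ℂ) : ofParameters x ∈ parameterSpace G :=
  fun _ _ hij hG => ofParameters_apply_of_not _ (not_or.mpr ⟨hij, hG⟩)

theorem ofParameters_entries {A : Matrix V V ℂ} (hA : A ∈ parameterSpace G) :
    ofParameters (fun e : Position G => A e.1.1 e.1.2) = A := by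
  ext i j
  by_cases h : i = j ∨ G.Adj j i
  · rw [ofParameters_apply _ ⟨(i, j), h⟩]
  · rw [ofParameters_apply_of_not _ h, hA i j (not_or.mp h).1 (not_or.mp h).2]

theorem ofParameters_perturb (x y : Position G → ℂ) :
    ofParameters (fun e => TrivSqZeroExt.inl (x e) + TrivSqZeroExt.inr (y e)) =
      perturb (ofParameters x) (ofParameters y) := by
  ext i j <;> by_cases h : i = j ∨ G.Adj j i
  · simp [ofParameters_apply _ (⟨(i, j), h⟩ : Position G)]
  · simp [ofParameters_apply_of_not _ h]
  · simp [ofParameters_apply _ (⟨(i, j), h⟩ : Position G)]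
  · simp [ofParameters_apply_of_not _ h]

end Parameters

/-- First-order Taylor expansion of a polynomial over the dual numbers. -/
theorem aeval_inl_add_inr {ι : Type*} [Fintype ι] (x y : ι → ℂ) (p : MvPolynomial ι ℂ) :
    aeval (fun e => (TrivSqZeroExt.inl (x e) + TrivSqZeroExt.inr (y e) : DualNumber ℂ)) p =
      TrivSqZeroExt.inl (eval x p) +
        TrivSqZeroExt.inr (∑ e, eval x (pderiv e p) * y e) := by
  classical
  induction p using MvPolynomial.induction_on with
  | C a =>
    simp [TrivSqZeroExt.algebraMap_eq_inl]
  | add p q hp hq =>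
    rw [map_add, hp, hq]
    ext <;> simp [add_mul, Finset.sum_add_distrib]
  | mul_X p j hp =>
    rw [map_mul, hp, aeval_X]
    ext
    · simp
    · simp only [TrivSqZeroExt.snd_mul, TrivSqZeroExt.fst_add, TrivSqZeroExt.fst_inl,
        TrivSqZeroExt.fst_inr, TrivSqZeroExt.snd_add, TrivSqZeroExt.snd_inl,
        TrivSqZeroExt.snd_inr, add_zero, zero_add, pderiv_mul, map_add, map_mul, eval_X, add_mul,
        Finset.sum_add_distrib, smul_eq_mul, MulOpposite.smul_eq_mul_unop, MulOpposite.unop_op]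
      have h1 : ∑ e, eval x p * eval x (pderiv e (X j)) * y e = eval x p * y j := by
        rw [Finset.sum_eq_single j]
        · simp
        · intro e _ he
          simp [pderiv_X, he]
        · simp
      have h2 : ∑ e, eval x (pderiv e p) * x j * y e = (∑ e, eval x (pderiv e p) * y e) * x j := by
        rw [Finset.sum_mul]
        exact Finset.sum_congr rfl fun e _ => by ring
      rw [h1, h2]
      ring

/-- Both polynomials are monic of degree `d`, so only the coefficients below `d` carry information.
-/
theorem charpoly_eq_iff {W S : Type*} [Fintype W] [DecidableEq W] [CommRing S]
    (M N : Matrix W W S) {d : ℕ} (hd : Fintype.card W = d) :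
    M.charpoly = N.charpoly ↔ ∀ i : Fin d, M.charpoly.coeff i.rev = N.charpoly.coeff i.rev := by
  refine ⟨fun h i => by rw [h], fun h => ?_⟩
  nontriviality S
  ext k
  have hM := charpoly_natDegree_eq_dim M
  have hN := charpoly_natDegree_eq_dim N
  rcases lt_trichotomy k d with hk | rfl | hk
  · have := h (Fin.rev ⟨k, hk⟩)
    rwa [Fin.rev_rev] at this
  · have h1 := (charpoly_monic M).coeff_natDegree
    have h2 := (charpoly_monic N).coeff_natDegree
    rw [hM, hd] at h1
    rw [hN, hd] at h2
    rw [h1, h2]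
  · rw [Polynomial.coeff_eq_zero_of_natDegree_lt (by omega),
      Polynomial.coeff_eq_zero_of_natDegree_lt (by omega)]

section Coordinates

variable {V : Type*} [Fintype V] [DecidableEq V] (G : Digraph V) (r : V)

/-- The double characteristic polynomial coefficients of a matrix over any commutative ring. -/
noncomputable def doubleCharpolyCoeff {S : Type*} [CommRing S] (A : Matrix V V S) :
    Fin (Fintype.card V) ⊕ Fin (Fintype.card V - 1) → S :=
  Sum.elim (fun i => A.charpoly.coeff i.rev) (fun i =>
    (A.submatrix (Subtype.val : {v // v ≠ r} → V) Subtype.val).charpoly.coeff i.rev)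

theorem doubleCharpolyCoeff_map {S T : Type*} [CommRing S] [CommRing T] (φ : S →+* T)
    (A : Matrix V V S) (k) : doubleCharpolyCoeff r (A.map φ) k = φ (doubleCharpolyCoeff r A k) := by
  rcases k with i | i
  · simp only [doubleCharpolyCoeff, Sum.elim_inl, charpoly_map, Polynomial.coeff_map]
  · simp only [doubleCharpolyCoeff, Sum.elim_inr]
    rw [← Polynomial.coeff_map, ← charpoly_map, submatrix_map]

theorem doubleCharpolyCoeff_eq_iff {S : Type*} [CommRing S] (A B : Matrix V V S) :
    doubleCharpolyCoeff r A = doubleCharpolyCoeff r B ↔ A.charpoly = B.charpoly ∧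
      (A.submatrix (Subtype.val : {v // v ≠ r} → V) Subtype.val).charpoly =
      (B.submatrix (Subtype.val : {v // v ≠ r} → V) Subtype.val).charpoly := by
  rw [charpoly_eq_iff A B rfl, charpoly_eq_iff _ _ (d := Fintype.card V - 1) (by simp),
    _root_.funext_iff, Sum.forall]
  rfl

/-- The coordinates of the double characteristic polynomial map as polynomials in the parameters. -/
noncomputable def coordinatePolynomial (k : Fin (Fintype.card V) ⊕ Fin (Fintype.card V - 1)) :
    MvPolynomial (Position G) ℂ :=
  doubleCharpolyCoeff r (ofParameters X) k

variable {G}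

theorem map_coordinatePolynomial {S : Type*} [CommRing S]
    (φ : MvPolynomial (Position G) ℂ →+* S) (k) :
    φ (coordinatePolynomial G r k) = doubleCharpolyCoeff r (ofParameters fun e => φ (X e)) k := by
  rw [coordinatePolynomial, ← doubleCharpolyCoeff_map, ofParameters_map]

theorem image_doubleCharpolyMap :
    doubleCharpolyMap r '' (parameterSpace G : Set (Matrix V V ℂ)) =
      Set.range fun (x : Position G → ℂ) k => eval x (coordinatePolynomial G r k) := by
  have h : ∀ x : Position G → ℂ, (fun k => eval x (coordinatePolynomial G r k)) =
      doubleCharpolyMap r (ofParameters x) := by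
    intro x
    funext k
    rw [map_coordinatePolynomial]
    simp only [eval_X]
    rfl
  ext c
  constructor
  · rintro ⟨A, hA, rfl⟩
    exact ⟨fun e => A e.1.1 e.1.2, (h _).trans (by rw [ofParameters_entries hA])⟩
  · rintro ⟨x, rfl⟩
    exact ⟨ofParameters x, ofParameters_mem x, (h x).symm⟩

/-- The kernel of the Jacobian matrix consists of the first-order deformations that preserve both
characteristic polynomials. -/
theorem jacobian_mulVec_eq_zero_iff (x y : Position G → ℂ) :
    (jacobian (coordinatePolynomial G r)).map (eval x) *ᵥ y = 0 ↔
      (perturb (ofParameters x) (ofParameters y)).charpoly =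
          (perturb (ofParameters x) 0).charpoly ∧
        ((perturb (ofParameters x) (ofParameters y)).submatrix
            (Subtype.val : {v // v ≠ r} → V) Subtype.val).charpoly =
          ((perturb (ofParameters x) 0).submatrix
            (Subtype.val : {v // v ≠ r} → V) Subtype.val).charpoly := by
  -- The coordinates commute with ring homomorphisms, so evaluating them over the dual numbers gives
  -- their Taylor expansion, whose `ε`-part is the Jacobian applied to `y`.
  have h : ∀ (y : Position G → ℂ) k,
      doubleCharpolyCoeff r (perturb (ofParameters x) (ofParameters y)) k =
        TrivSqZeroExt.inl (eval x (coordinatePolynomial G r k)) + TrivSqZeroExt.inr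
          (((jacobian (coordinatePolynomial G r)).map (eval x) *ᵥ y) k) := by
    intro y k
    have h1 := aeval_inl_add_inr x y (coordinatePolynomial G r k)
    let φ : MvPolynomial (Position G) ℂ →ₐ[ℂ] DualNumber ℂ := aeval (fun e : Position G =>
      (TrivSqZeroExt.inl (x e) + TrivSqZeroExt.inr (y e) : DualNumber ℂ))
    have h2 := map_coordinatePolynomial r (φ : MvPolynomial (Position G) ℂ →+* DualNumber ℂ) k
    simp only [RingHom.coe_coe, φ, aeval_X, ofParameters_perturb] at h2
    rw [← h2, h1]
    rfl
  have h0 : (0 : Matrix V V ℂ) = ofParameters (0 : Position G → ℂ) := by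
    ext i j
    simp [ofParameters]
  rw [← doubleCharpolyCoeff_eq_iff, h0, _root_.funext_iff, _root_.funext_iff]
  refine forall_congr' fun k => ?_
  rw [h, h, mulVec_zero, add_right_inj, TrivSqZeroExt.inr_injective.eq_iff]

end Coordinates

end CompartmentModel

/-! ### The kernel of the Jacobian as a space of commutators. -/

namespace CompartmentModel

open MvPolynomial Matrix

variable {V : Type*} [Fintype V] [DecidableEq V] (G : Digraph V) (r : V)

/-- The matrices `X`, with vanishing row and column at `r`, for which `[X, A]` is tangent to the
parameter space. -/
def commutatorSpace (A : Matrix V V ℂ) : Submodule ℂ (Matrix V V ℂ) where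
  carrier := {X | (∀ i, X r i = 0 ∧ X i r = 0) ∧ X * A - A * X ∈ parameterSpace G}
  zero_mem' := ⟨fun _ => ⟨rfl, rfl⟩, by simp⟩
  add_mem' := fun {X Y} hX hY => by
    refine ⟨fun i => ⟨?_, ?_⟩, ?_⟩
    · rw [Matrix.add_apply, (hX.1 i).1, (hY.1 i).1, add_zero]
    · rw [Matrix.add_apply, (hX.1 i).2, (hY.1 i).2, add_zero]
    · have : (X + Y) * A - A * (X + Y) = (X * A - A * X) + (Y * A - A * Y) := by noncomm_ring
      rw [this]
      exact add_mem hX.2 hY.2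
  smul_mem' := fun c X hX => by
    refine ⟨fun i => ⟨?_, ?_⟩, ?_⟩
    · rw [Matrix.smul_apply, (hX.1 i).1, smul_zero]
    · rw [Matrix.smul_apply, (hX.1 i).2, smul_zero]
    · rw [smul_mul_assoc, mul_smul_comm, ← smul_sub]
      exact Submodule.smul_mem _ _ hX.2

variable {G r}

/-- The map `X ↦ [X, A]` identifies the two spaces: it is injective because no nonzero such `X`
commutes with a controllable `A`, and its image is the whole kernel by
`Controllable.exists_commutator`. -/
theorem finrank_commutatorSpace {x : Position G → ℂ} (hA : Controllable r (ofParameters x)) :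
    Module.finrank ℂ (commutatorSpace G r (ofParameters x)) =
      Module.finrank ℂ
        (LinearMap.ker ((jacobian (coordinatePolynomial G r)).map (eval x)).mulVecLin) := by
  set A := ofParameters x
  let Φ : commutatorSpace G r A →ₗ[ℂ] (Position G → ℂ) :=
    { toFun := fun X e => (X.1 * A - A * X.1) e.1.1 e.1.2
      map_add' := fun X Y => by
        ext e
        simp [add_mul, mul_add]
        ring
      map_smul' := fun c X => by
        ext e
        simp [mul_sub] }
  have hΦ : ∀ X, ofParameters (Φ X) = X.1 * A - A * X.1 := fun X => ofParameters_entries X.2.2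
  have hinj : Function.Injective Φ := by
    rw [injective_iff_map_eq_zero]
    intro X hX
    refine Subtype.ext (hA.eq_zero_of_commute (fun i => (X.2.1 i).2) ?_)
    rw [← hΦ, hX]
    ext i j
    simp [ofParameters]
  have hrange : LinearMap.range Φ =
      LinearMap.ker ((jacobian (coordinatePolynomial G r)).map (eval x)).mulVecLin := by
    ext y
    rw [LinearMap.mem_ker, mulVecLin_apply, jacobian_mulVec_eq_zero_iff]
    constructor
    · rintro ⟨X, rfl⟩
      rw [hΦ]
      refine ⟨charpoly_perturb_commutator _ _, ?_⟩
      have h : ∀ B, (perturb A B).submatrix (Subtype.val : {v // v ≠ r} → V)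
          (Subtype.val : {v // v ≠ r} → V) =
          perturb (A.submatrix (Subtype.val : {v // v ≠ r} → V) (Subtype.val : {v // v ≠ r} → V))
            (B.submatrix (Subtype.val : {v // v ≠ r} → V) (Subtype.val : {v // v ≠ r} → V)) :=
        fun B => rfl
      rw [h, h, submatrix_commutator X.2.1, charpoly_perturb_commutator]
      rfl
    · rintro ⟨h, h'⟩
      obtain ⟨X, hX, hXA⟩ := hA.exists_commutator h h'
      refine ⟨⟨X, hX, by rw [hXA]; exact ofParameters_mem y⟩, ?_⟩
      ext e
      change (X * A - A * X) e.1.1 e.1.2 = y e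
      rw [hXA, ofParameters_apply]
  rw [← hrange, LinearMap.finrank_range_of_inj hinj]

/-- Commutators of `A` with diagonal matrices never leave the parameter space, so the diagonal
matrices vanishing at `r` always contribute `n - 1` dimensions. Subtracting its diagonal turns any
further element into a zero-diagonal one. -/
theorem finrank_commutatorSpace_eq_iff {A : Matrix V V ℂ} (hA : A ∈ parameterSpace G) :
    Module.finrank ℂ (commutatorSpace G r A) = Fintype.card V - 1 ↔
      ¬ ∃ X : Matrix V V ℂ, X ≠ 0 ∧ (∀ i : V, X r i = 0 ∧ X i r = 0 ∧ X i i = 0) ∧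
        X * A - A * X ∈ parameterSpace G := by
  have hdiag : ∀ d : V → ℂ, diagonal d * A - A * diagonal d ∈ parameterSpace G := by
    intro d i j hij hG
    rw [Matrix.sub_apply, diagonal_mul, mul_diagonal, hA i j hij hG, mul_zero, zero_mul, sub_zero]
  let D : ({v // v ≠ r} → ℂ) →ₗ[ℂ] Matrix V V ℂ :=
    diagonalLinearMap V ℂ ℂ ∘ₗ Function.ExtendByZero.linearMap ℂ (Subtype.val : {v // v ≠ r} → V)
  have hD : ∀ d, D d = diagonal (Function.extend Subtype.val d 0) := fun d => rfl
  have hDr : ∀ d i, D d r i = 0 ∧ D d i r = 0 := by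
    intro d i
    have h0 : Function.extend (Subtype.val : {v // v ≠ r} → V) d 0 r = 0 := by
      rw [Function.extend_apply']
      · rfl
      · rintro ⟨v, hv⟩
        exact v.2 hv
    rw [hD, diagonal_apply, diagonal_apply]
    refine ⟨?_, ?_⟩ <;> split_ifs with h
    · exact h0
    · rfl
    · rw [h, h0]
    · rfl
  let Ψ : ({v // v ≠ r} → ℂ) →ₗ[ℂ] commutatorSpace G r A :=
    D.codRestrict _ fun d => ⟨hDr d, hdiag _⟩
  have hΨ : ∀ d v, (Ψ d).1 v v = Function.extend (Subtype.val : {v // v ≠ r} → V) d 0 v :=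
    fun d v => diagonal_apply_eq _ _
  have hinj : Function.Injective Ψ := by
    intro d d' h
    ext v
    have := congrArg (fun X => X.1 v.1 v.1) h
    simpa only [hΨ, Subtype.val_injective.extend_apply] using this
  have hcard : Module.finrank ℂ ({v // v ≠ r} → ℂ) = Fintype.card V - 1 := by simp
  have hsurj : Module.finrank ℂ (commutatorSpace G r A) = Fintype.card V - 1 ↔
      Function.Surjective Ψ := by
    constructor
    · intro h
      exact (LinearMap.injective_iff_surjective_of_finrank_eq_finrank (hcard.trans h.symm)).mp hinj
    · intro h
      rw [← hcard, (LinearEquiv.ofBijective Ψ ⟨hinj, h⟩).finrank_eq]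
  rw [hsurj]
  constructor
  · rintro h ⟨X, hX0, hX, hXA⟩
    obtain ⟨d, hd⟩ := h ⟨X, fun i => ⟨(hX i).1, (hX i).2.1⟩, hXA⟩
    refine hX0 ?_
    have hXd : X = diagonal (Function.extend (Subtype.val : {v // v ≠ r} → V) d 0) :=
      (congrArg Subtype.val hd).symm
    ext i j
    by_cases hij : i = j
    · rw [← hij, (hX i).2.2, Matrix.zero_apply]
    · rw [hXd, diagonal_apply_ne _ hij, Matrix.zero_apply]
  · intro h Z
    refine ⟨fun v => Z.1 v v, Subtype.ext ?_⟩
    by_contra hne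
    refine h ⟨Z.1 - Ψ (fun v => Z.1 v v), sub_ne_zero.mpr (Ne.symm hne), fun i => ?_, ?_⟩
    · refine ⟨?_, ?_, ?_⟩
      · rw [Matrix.sub_apply, (Z.2.1 i).1, ((Ψ _).2.1 i).1, sub_zero]
      · rw [Matrix.sub_apply, (Z.2.1 i).2, ((Ψ _).2.1 i).2, sub_zero]
      · rw [Matrix.sub_apply, hΨ, sub_eq_zero]
        by_cases hi : i = r
        · rw [← hΨ, hi, (Z.2.1 r).1, ((Ψ _).2.1 r).1]
        · exact (Subtype.val_injective.extend_apply (fun v : {v // v ≠ r} => Z.1 v v) 0 ⟨i, hi⟩).symm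
    · exact (Z - Ψ fun v => Z.1 v v).2.2

/-- At a controllable parameter, the Jacobian matrix of the double characteristic polynomial map has
the expected rank if and only if the commutator space contains no nonzero zero-diagonal matrix. -/
theorem rank_jacobian_eq_iff (hloop : ∀ v : V, ¬ G.Adj v v) {x : Position G → ℂ}
    (hA : Controllable r (ofParameters x)) :
    ((jacobian (coordinatePolynomial G r)).map (eval x)).rank = numEdges G + 1 ↔
      ¬ ∃ X : Matrix V V ℂ, X ≠ 0 ∧ (∀ i : V, X r i = 0 ∧ X i r = 0 ∧ X i i = 0) ∧
        X * ofParameters x - ofParameters x * X ∈ parameterSpace G := by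
  rw [← finrank_commutatorSpace_eq_iff (ofParameters_mem x), finrank_commutatorSpace hA]
  -- Rank plus nullity is `n + m`, so rank `m + 1` means nullity `n - 1`; the truncated subtraction
  -- is harmless because `r` shows `n > 0`.
  have h1 := LinearMap.finrank_range_add_finrank_ker
    ((jacobian (coordinatePolynomial G r)).map (eval x)).mulVecLin
  rw [Module.finrank_fintype_fun_eq_card, card_position G hloop, Nat.card_eq_fintype_card] at h1
  have h2 : 0 < Fintype.card V := Fintype.card_pos_iff.mpr ⟨r⟩
  rw [rank]
  omega

/-- Controllability holds at sufficiently general parameters of a strongly connected graph. -/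
theorem exists_forall_controllable (hconn : StronglyConnected G) (r : V) :
    ∃ g : MvPolynomial (Position G) ℂ, g ≠ 0 ∧
      ∀ x, eval x g ≠ 0 → Controllable r (ofParameters x) := by
  let g : MvPolynomial (Position G) ℂ :=
    ((controllabilityMatrix r (ofParameters X)).submatrix id (Fintype.equivFin V)).det
  have hg : ∀ x : Position G → ℂ, eval x g =
      ((controllabilityMatrix r (ofParameters x)).submatrix id (Fintype.equivFin V)).det := by
    intro x
    have h : (ofParameters X).map (eval x) = ofParameters (G := G) x := by
      rw [ofParameters_map]
      simp only [eval_X]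
    simp only [g, RingHom.map_det]
    congr 1
    ext i j
    rw [← h]
    simp only [RingHom.mapMatrix_apply, map_apply, submatrix_apply, controllabilityMatrix, of_apply,
      id]
    exact congrFun (congrFun (map_pow (eval x).mapMatrix _ _) i) r
  refine ⟨g, ?_, fun x hx => ?_⟩
  · obtain ⟨A, hA, hAc⟩ := exists_controllable hconn r
    rw [← ofParameters_entries hA, controllable_iff_det_ne_zero, ← hg] at hAc
    intro h
    exact hAc (by rw [h, map_zero])
  · rwa [controllable_iff_det_ne_zero, ← hg]

/-- A condition is generic on the parameter space as soon as it holds where some nonzero polynomial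
in the parameters does not vanish. -/
theorem forGeneric_iff {V : Type*} {G : Digraph V} {P : Matrix V V ℂ → Prop} :
    ForGeneric (parameterSpace G) P ↔ ∃ f : MvPolynomial (Position G) ℂ, f ≠ 0 ∧
      ∀ x, eval x f ≠ 0 → P (ofParameters x) := by
  constructor
  · rintro ⟨f, ⟨A, hA, hAf⟩, hf⟩
    let g : MvPolynomial (Position G) ℂ := aeval (fun e => ofParameters X e.1 e.2) f
    have hg : ∀ x, eval x g = eval (fun e => ofParameters x e.1 e.2) f := by
      intro x
      have h : (ofParameters X).map (eval x) = ofParameters (G := G) x := by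
        rw [ofParameters_map]
        simp only [eval_X]
      simp only [g, ← coe_aeval_eq_eval, RingHom.coe_coe, ← AlgHom.comp_apply]
      congr 1
      ext e
      simpa using congrFun (congrFun h e.1) e.2
    refine ⟨g, fun h => hAf ?_, fun x hx => hf _ (ofParameters_mem x) (by rwa [← hg])⟩
    rw [← ofParameters_entries hA, ← hg, h, map_zero]
  · rintro ⟨f, hf0, hf⟩
    have hren : ∀ A : Matrix V V ℂ, eval (fun e => A e.1 e.2) (rename Subtype.val f) =
        eval (fun e : Position G => A e.1.1 e.1.2) f := fun A => eval_rename _ _ _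
    refine ⟨rename Subtype.val f, ?_, fun A hA hAf => ?_⟩
    · by_contra! h
      refine hf0 (MvPolynomial.funext fun x => ?_)
      have := h (ofParameters x) (ofParameters_mem x)
      rw [hren] at this
      simpa only [ofParameters_apply, map_zero] using this
    · rw [hren] at hAf
      rw [← ofParameters_entries hA]
      exact hf _ hAf

end CompartmentModel

/-! ### The equivalence. -/

theorem corollary3p9 {V : Type*} [Fintype V] [DecidableEq V] (G : Digraph V) (r : V)
    (hloop : ∀ v : V, ¬ G.Adj v v) (hconn : CompartmentModel.StronglyConnected G) :
    CompartmentModel.HasExpectedDimension G r ↔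
      CompartmentModel.ForGeneric (CompartmentModel.parameterSpace G) (fun A =>
        ¬ ∃ X : Matrix V V ℂ, X ≠ 0 ∧
          (∀ i : V, X r i = 0 ∧ X i r = 0 ∧ X i i = 0) ∧
          X * A - A * X ∈ CompartmentModel.parameterSpace G) := by
  obtain ⟨f, hf0, hf⟩ := CompartmentModel.exists_forall_zariskiDim_range_eq_rank (CompartmentModel.coordinatePolynomial G r)
  obtain ⟨g, hg0, hg⟩ := CompartmentModel.exists_forall_controllable hconn r
  -- The left side does not depend on `x`. Hence the criterion holds either at all points where `f`
  -- and `g` are nonzero or at none of them, and a single such point decides.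
  have key : ∀ x : CompartmentModel.Position G → ℂ, MvPolynomial.eval x f ≠ 0 → MvPolynomial.eval x g ≠ 0 →
      (CompartmentModel.HasExpectedDimension G r ↔ ¬ ∃ X : Matrix V V ℂ, X ≠ 0 ∧
        (∀ i : V, X r i = 0 ∧ X i r = 0 ∧ X i i = 0) ∧
          X * CompartmentModel.ofParameters x - CompartmentModel.ofParameters x * X ∈ CompartmentModel.parameterSpace G) := by
    intro x hxf hxg
    rw [← CompartmentModel.rank_jacobian_eq_iff hloop (hg x hxg), CompartmentModel.HasExpectedDimension, CompartmentModel.image_doubleCharpolyMap,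
      hf x hxf]
    exact_mod_cast Iff.rfl
  rw [CompartmentModel.forGeneric_iff]
  constructor
  · intro h
    refine ⟨f * g, mul_ne_zero hf0 hg0, fun x hx => ?_⟩
    rw [map_mul] at hx
    exact (key x (left_ne_zero_of_mul hx) (right_ne_zero_of_mul hx)).mp h
  · rintro ⟨h, hh0, hh⟩
    have hne : f * g * h ≠ 0 := mul_ne_zero (mul_ne_zero hf0 hg0) hh0
    obtain ⟨x, hx⟩ : ∃ x, MvPolynomial.eval x (f * g * h) ≠ 0 := by
      by_contra! h0
      exact hne (MvPolynomial.funext fun x => by rw [h0, map_zero])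
    rw [map_mul, map_mul] at hx
    have hx' := left_ne_zero_of_mul hx
    exact (key x (left_ne_zero_of_mul hx') (right_ne_zero_of_mul hx')).mpr
      (hh x (right_ne_zero_of_mul hx))
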